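/- **Theorem 2.5 (Convex reformulation).** Let $p\ge 1$ and $\rho>0$. Let $\mathcal X$ be an arbitrary set of symmetric positive definite real $p\times p$ matrices. Write $A\succ B$ ($A\succeq B$) if $A-B$ is symmetric positive definite (semidefinite), and $\langle A,B\rangle=\operatorname{Tr}(A^\top B)$. For probability measures $P,Q$ on $\mathbb R^p$ let $$W(P,Q)=\inf_{\Pi}\Big(\int\|x-y\|^2\,\Pi(dx,dy)\Big)^{1/2},$$ where $\Pi$ ranges over the joint distributions with marginals $P$ and $Q$. Let $\mathcal N_0^p=\{\mathcal N(0,S): S\succeq 0\}$ be the set of all (possibly degenerate) zero-mean normal distributions on $\mathbb R^p$. For $\widehat\Sigma\succeq 0$ define $$\mathcal J(\widehat\Sigma)=\inf_{X\in\mathcal X}\Big\{-\log\det X+\sup\big\{\mathbb E^{Q}[\langle\xi\xi^\top,X\rangle] : Q\in\mathcal N_0^p,\ W(Q,\mathcal N(0,\widehat\Sigma))\le\rho\big\}\Big\},$$ with values in $[-\infty,\infty]$ and $\inf\emptyset=+\infty$. Then, for every $\widehat\Sigma\succeq 0$, $$\mathcal J(\widehat\Sigma)=\inf\Big\{-\log\det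 X+\gamma\big(\rho^2-\operatorname{Tr}\widehat\Sigma\big)+\gamma^2\big\langle(\gamma I-X)^{-1},\widehat\Sigma\big\rangle : X\in\mathcal X,\ \gamma\in\mathbb R,\ \gamma I\succ X\succ 0\Big\},$$ and the two problems are equivalent in the sense that, for each fixed $X\in\mathcal X$, the infimum of the right-hand objective over all $\gamma\in\mathbb R$ with $\gamma I\succ X$ equals the expression in braces in the definition of $\mathcal J(\widehat\Sigma)$. If $\mathcal X\neq\emptyset$, then $\mathcal J(\widehat\Sigma)$ is finite for every $\widehat\Sigma\succeq 0$. Moreover, $\mathcal J$ is continuous on the set of positive semidefinite $p\times p$ matrices. -/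

import Mathlib

open MeasureTheory ProbabilityTheory
open scoped ENNReal

namespace WassersteinShrinkage

/-- The type-2 Wasserstein distance between two distributions on `ℝ^p`: the infimum, over all
couplings `π` of `P` and `Q`, of `(∫ ‖x - y‖² dπ(x, y))^(1/2)`, with values in `[0, ∞]`. -/
noncomputable def wasserstein {p : ℕ} (P Q : Measure (EuclideanSpace ℝ (Fin p))) : ℝ≥0∞ :=
  ⨅ (π : Measure (EuclideanSpace ℝ (Fin p) × EuclideanSpace ℝ (Fin p)))
    (_ : π.map Prod.fst = P ∧ π.map Prod.snd = Q),
    (∫⁻ z, ‖z.1 - z.2‖ₑ ^ 2 ∂π) ^ (1 / 2 : ℝ)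

/-- The trace inner product `⟨A, B⟩ = Tr(Aᵀ B)`. -/
def frobInner {p : ℕ} (A B : Matrix (Fin p) (Fin p) ℝ) : ℝ :=
  (A.transpose * B).trace

/-- The (possibly degenerate) normal distributions on `ℝ^p` with mean zero. -/
def centeredNormals (p : ℕ) : Set (Measure (EuclideanSpace ℝ (Fin p))) :=
  {Q | ∃ S : Matrix (Fin p) (Fin p) ℝ, S.PosSemidef ∧ Q = multivariateGaussian 0 S}

/-- The ambiguity set: the mean-zero normal distributions whose Wasserstein distance from
`N(0, S)` is at most `ρ`. -/
noncomputable def ambiguitySet {p : ℕ} (ρ : ℝ) (S : Matrix (Fin p) (Fin p) ℝ) :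
    Set (Measure (EuclideanSpace ℝ (Fin p))) :=
  {Q ∈ centeredNormals p | wasserstein Q (multivariateGaussian 0 S) ≤ ENNReal.ofReal ρ}

/-- The worst-case loss `-log det X + sup_Q E^Q[⟨ξ ξᵀ, X⟩]`, the supremum being taken over the
ambiguity set. -/
noncomputable def worstCaseLoss {p : ℕ} (ρ : ℝ) (S X : Matrix (Fin p) (Fin p) ℝ) : EReal :=
  ((-Real.log X.det : ℝ) : EReal) +
    ⨆ Q ∈ ambiguitySet ρ S, ((∫ ξ, frobInner (Matrix.vecMulVec ξ.ofLp ξ.ofLp) X ∂Q : ℝ) : EReal)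

/-- The optimal value of the mean-zero distributionally robust estimation problem over the set `𝒳`
of admissible precision matrices. -/
noncomputable def droValue {p : ℕ} (ρ : ℝ) (𝒳 : Set (Matrix (Fin p) (Fin p) ℝ))
    (S : Matrix (Fin p) (Fin p) ℝ) : EReal :=
  ⨅ X ∈ 𝒳, worstCaseLoss ρ S X

/-- The objective `-log det X + γ (ρ² - Tr S) + γ² ⟨(γ I - X)⁻¹, S⟩`. -/
noncomputable def convexObjective {p : ℕ} (ρ : ℝ) (S X : Matrix (Fin p) (Fin p) ℝ) (γ : ℝ) : ℝ :=
  -Real.log X.det + γ * (ρ ^ 2 - S.trace) +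
    γ ^ 2 * frobInner (γ • (1 : Matrix (Fin p) (Fin p) ℝ) - X)⁻¹ S

/-- The optimal value of the convex program: the infimum of the objective over all `X ∈ 𝒳` and
`γ ∈ ℝ` with `γ I ≻ X ≻ 0`. -/
noncomputable def convexValue {p : ℕ} (ρ : ℝ) (𝒳 : Set (Matrix (Fin p) (Fin p) ℝ))
    (S : Matrix (Fin p) (Fin p) ℝ) : EReal :=
  ⨅ (X : Matrix (Fin p) (Fin p) ℝ) (γ : ℝ)
    (_ : X ∈ 𝒳 ∧ (γ • (1 : Matrix (Fin p) (Fin p) ℝ) - X).PosDef ∧ X.PosDef),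
    ((convexObjective ρ S X γ : ℝ) : EReal)

end WassersteinShrinkage

/-! Fix `X`, let `l` be its top eigenvalue and `A` the square root of `S`. The supremum over normal
laws is squeezed between a finite-dimensional maximum and its Lagrangian dual. Pushing one standard
normal through `B` and `A` couples `N(0, B Bᵀ)` with `N(0, S)` at cost `‖B - A‖²` (Frobenius), so
the supremum is at least `maxQuad`, the maximum of `Tr(Bᵀ X B)` over the ball of radius `ρ` around
`A`. Conversely, completing a square pointwise and integrating over a coupling bounds it by
`dualBound` for every `γ > l` (`integral_frobInner_le`). The gap closes because this trust-region
problem has strong duality (`exists_trace_ge_dualBound`); no closed formula for the distance between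
normal laws is needed.

Continuity must be uniform over the arbitrary set `𝒳`. Moving the centre of the ball changes
`maxQuad` by a factor near 1 that does not depend on `X` (`maxQuad_le_mul`), since `l ρ² ≤ maxQuad`.
The same bound makes the loss control `maxQuad` (`exists_maxQuad_le`), which turns the factor into
an estimate between optimal values (`realValue_ge`). -/

namespace WassersteinShrinkage

open Matrix

/-! ### Gaussian moments, the linear coupling and weak duality -/

section Gaussian

variable {p : ℕ}

theorem real_inner_eq_dotProduct (x y : EuclideanSpace ℝ (Fin p)) :
    inner ℝ x y = x.ofLp ⬝ᵥ y.ofLp := by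
  simp [PiLp.inner_apply, dotProduct, mul_comm]

/-- The image of the standard normal distribution under `B` is `N(0, B Bᵀ)`. -/
theorem map_stdGaussian_toEuclideanCLM (B : Matrix (Fin p) (Fin p) ℝ) :
    (stdGaussian (EuclideanSpace ℝ (Fin p))).map (toEuclideanCLM (𝕜 := ℝ) B) =
      multivariateGaussian 0 (B * Bᵀ) := by
  have hB : (B * Bᵀ).PosSemidef := by
    simpa using posSemidef_self_mul_conjTranspose B
  apply IsGaussian.ext
  · simp only [id_eq, integral_id_multivariateGaussian]
    rw [ContinuousLinearMap.integral_id_map IsGaussian.integrable_id]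
    simp
  · ext x y
    rw [covarianceBilin_map IsGaussian.memLp_two_id, covarianceBilin_multivariateGaussian hB,
      covarianceBilin_stdGaussian, innerSL_apply_apply, ← ContinuousLinearMap.star_eq_adjoint,
      ← map_star, real_inner_eq_dotProduct, ofLp_toEuclideanCLM, ofLp_toEuclideanCLM,
      star_eq_conjTranspose, conjTranspose_eq_transpose_of_trivial, ← mulVec_mulVec,
      dotProduct_mulVec x.ofLp B, ← mulVec_transpose]

theorem integrable_mul_multivariateGaussian (S : Matrix (Fin p) (Fin p) ℝ) (i j : Fin p) :
    Integrable (fun x : EuclideanSpace ℝ (Fin p) => x i * x j) (multivariateGaussian 0 S) := by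
  have h (k : Fin p) : MemLp (fun x : EuclideanSpace ℝ (Fin p) => x k) 2
      (multivariateGaussian 0 S) :=
    (EuclideanSpace.proj (𝕜 := ℝ) k).comp_memLp' IsGaussian.memLp_two_id
  exact (h i).integrable_mul (h j)

theorem integral_mul_multivariateGaussian {S : Matrix (Fin p) (Fin p) ℝ} (hS : S.PosSemidef)
    (i j : Fin p) :
    ∫ x : EuclideanSpace ℝ (Fin p), x i * x j ∂(multivariateGaussian 0 S) = S i j := by
  have h (k : Fin p) : MemLp (fun x : EuclideanSpace ℝ (Fin p) => x k) 2
      (multivariateGaussian 0 S) :=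
    (EuclideanSpace.proj (𝕜 := ℝ) k).comp_memLp' IsGaussian.memLp_two_id
  have h0 (k : Fin p) :
      ∫ x : EuclideanSpace ℝ (Fin p), x k ∂(multivariateGaussian 0 S) = 0 := by
    have := ContinuousLinearMap.integral_comp_id_comm (μ := multivariateGaussian 0 S)
      IsGaussian.integrable_id (EuclideanSpace.proj (𝕜 := ℝ) k)
    simpa using this
  have := covariance_eval_multivariateGaussian (μ := 0) hS i j
  rw [covariance_eq_sub (h i) (h j), h0, zero_mul, sub_zero] at this
  exact this

theorem dotProduct_mulVec_eq_sum (M : Matrix (Fin p) (Fin p) ℝ) (x y : Fin p → ℝ) :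
    x ⬝ᵥ M *ᵥ y = ∑ i, ∑ j, M i j * (x i * y j) := by
  simp only [dotProduct, mulVec, Finset.mul_sum]
  exact Finset.sum_congr rfl fun i _ => Finset.sum_congr rfl fun j _ => by ring

theorem integrable_quadratic_multivariateGaussian (S M : Matrix (Fin p) (Fin p) ℝ) :
    Integrable (fun x : EuclideanSpace ℝ (Fin p) => x.ofLp ⬝ᵥ M *ᵥ x.ofLp)
      (multivariateGaussian 0 S) := by
  simp only [dotProduct_mulVec_eq_sum]
  exact integrable_finsetSum _ fun i _ => integrable_finsetSum _ fun j _ =>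
    (integrable_mul_multivariateGaussian S i j).const_mul _

theorem integral_quadratic_multivariateGaussian {S : Matrix (Fin p) (Fin p) ℝ}
    (hS : S.PosSemidef) (M : Matrix (Fin p) (Fin p) ℝ) :
    ∫ x : EuclideanSpace ℝ (Fin p), x.ofLp ⬝ᵥ M *ᵥ x.ofLp ∂(multivariateGaussian 0 S) =
      (Mᵀ * S).trace := by
  simp only [dotProduct_mulVec_eq_sum]
  have hI (i j : Fin p) : Integrable (fun x : EuclideanSpace ℝ (Fin p) => M i j * (x i * x j))
      (multivariateGaussian 0 S) := (integrable_mul_multivariateGaussian S i j).const_mul _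
  rw [integral_finsetSum _ fun i _ => integrable_finsetSum _ fun j _ => hI i j]
  simp only [trace, diag, Matrix.mul_apply, transpose_apply]
  rw [Finset.sum_comm]
  refine Finset.sum_congr rfl fun i _ => ?_
  rw [integral_finsetSum _ fun j _ => hI i j]
  refine Finset.sum_congr rfl fun j _ => ?_
  rw [integral_const_mul, integral_mul_multivariateGaussian hS]

theorem integrable_quadratic_of_map_eq {Ω : Type*} [MeasurableSpace Ω] {π : Measure Ω}
    {f : Ω → EuclideanSpace ℝ (Fin p)} (hf : Measurable f) {S : Matrix (Fin p) (Fin p) ℝ}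
    (h : π.map f = multivariateGaussian 0 S) (M : Matrix (Fin p) (Fin p) ℝ) :
    Integrable (fun z => (f z).ofLp ⬝ᵥ M *ᵥ (f z).ofLp) π := by
  have := integrable_quadratic_multivariateGaussian S M
  rw [← h] at this
  exact this.comp_measurable hf

theorem integral_quadratic_of_map_eq {Ω : Type*} [MeasurableSpace Ω] {π : Measure Ω}
    {f : Ω → EuclideanSpace ℝ (Fin p)} (hf : Measurable f) {S : Matrix (Fin p) (Fin p) ℝ}
    (h : π.map f = multivariateGaussian 0 S) (M : Matrix (Fin p) (Fin p) ℝ) :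
    ∫ z, (f z).ofLp ⬝ᵥ M *ᵥ (f z).ofLp ∂π =
      ∫ x : EuclideanSpace ℝ (Fin p), x.ofLp ⬝ᵥ M *ᵥ x.ofLp ∂(multivariateGaussian 0 S) := by
  have := (integrable_quadratic_multivariateGaussian S M).aestronglyMeasurable
  rw [← h] at this ⊢
  exact (integral_map hf.aemeasurable this).symm

theorem frobInner_vecMulVec (x : Fin p → ℝ) (X : Matrix (Fin p) (Fin p) ℝ) :
    frobInner (vecMulVec x x) X = x ⬝ᵥ X *ᵥ x := by
  rw [frobInner, transpose_vecMulVec, vecMulVec_mul, trace_vecMulVec, dotProduct_mulVec,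
    dotProduct_comm]

theorem norm_sq_eq_dotProduct (x : EuclideanSpace ℝ (Fin p)) :
    ‖x‖ ^ 2 = x.ofLp ⬝ᵥ x.ofLp := by
  rw [EuclideanSpace.real_norm_sq_eq]
  simp [dotProduct, sq]

/-- The distance of `N(0, B Bᵀ)` from `N(0, A Aᵀ)` is at most the Frobenius distance of `B`
from `A`. -/
theorem wasserstein_le_of_trace_le {S A B : Matrix (Fin p) (Fin p) ℝ} {ρ : ℝ} (hρ : 0 ≤ ρ)
    (hA : A * Aᵀ = S) (h : ((B - A)ᵀ * (B - A)).trace ≤ ρ ^ 2) :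
    wasserstein (multivariateGaussian 0 (B * Bᵀ)) (multivariateGaussian 0 S) ≤
      ENNReal.ofReal ρ := by
  set G := stdGaussian (EuclideanSpace ℝ (Fin p)) with hG
  let TB := toEuclideanCLM (𝕜 := ℝ) B
  let TA := toEuclideanCLM (𝕜 := ℝ) A
  have hm : Measurable fun z : EuclideanSpace ℝ (Fin p) => (TB z, TA z) := by fun_prop
  -- Both marginals are driven by the same standard normal vector.
  refine iInf₂_le_of_le (G.map fun z => (TB z, TA z)) ⟨?_, ?_⟩ ?_
  · rw [Measure.map_map measurable_fst hm, ← map_stdGaussian_toEuclideanCLM]; rfl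
  · rw [Measure.map_map measurable_snd hm, ← hA, ← map_stdGaussian_toEuclideanCLM]; rfl
  · have key : ∫⁻ z, ‖z.1 - z.2‖ₑ ^ 2 ∂(G.map fun z => (TB z, TA z)) ≤
        ENNReal.ofReal (ρ ^ 2) := by
      rw [lintegral_map (by fun_prop) hm]
      have h1 (z : EuclideanSpace ℝ (Fin p)) : ‖TB z - TA z‖ₑ ^ 2 =
          ENNReal.ofReal (z.ofLp ⬝ᵥ ((B - A)ᵀ * (B - A)) *ᵥ z.ofLp) := by
        rw [← ofReal_norm, ← ENNReal.ofReal_pow (norm_nonneg _), norm_sq_eq_dotProduct,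
          WithLp.ofLp_sub, ofLp_toEuclideanCLM, ofLp_toEuclideanCLM, ← sub_mulVec,
          ← mulVec_mulVec, dotProduct_mulVec z.ofLp, vecMul_transpose]
      simp only [h1]
      rw [hG, ← multivariateGaussian_zero_one, ← ofReal_integral_eq_lintegral_ofReal
        (integrable_quadratic_multivariateGaussian _ _), integral_quadratic_multivariateGaussian
        PosSemidef.one]
      · apply ENNReal.ofReal_le_ofReal
        simpa [transpose_mul] using h
      · refine .of_forall fun z => ?_
        simp only [Pi.zero_apply]
        rw [← mulVec_mulVec, dotProduct_mulVec z.ofLp, vecMul_transpose]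
        rw [← WithLp.ofLp_toLp 2 ((B - A) *ᵥ z.ofLp), ← norm_sq_eq_dotProduct]
        positivity
    calc _ ≤ (ENNReal.ofReal (ρ ^ 2)) ^ (1 / 2 : ℝ) := by gcongr
      _ = ENNReal.ofReal ρ := by
        rw [ENNReal.ofReal_rpow_of_nonneg (by positivity) (by norm_num), ← Real.sqrt_eq_rpow,
          Real.sqrt_sq hρ]

/-- Completion of the square in the Lagrangian of the transport problem. -/
theorem quadratic_eq_of_posDef {X : Matrix (Fin p) (Fin p) ℝ} {γ : ℝ}
    (h : (γ • (1 : Matrix (Fin p) (Fin p) ℝ) - X).PosDef) (x y : Fin p → ℝ) :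
    x ⬝ᵥ X *ᵥ x = γ * ((x - y) ⬝ᵥ (x - y)) +
      (γ ^ 2 * (y ⬝ᵥ (γ • (1 : Matrix (Fin p) (Fin p) ℝ) - X)⁻¹ *ᵥ y) - γ * (y ⬝ᵥ y)) -
      (x - γ • (γ • (1 : Matrix (Fin p) (Fin p) ℝ) - X)⁻¹ *ᵥ y) ⬝ᵥ
        (γ • (1 : Matrix (Fin p) (Fin p) ℝ) - X) *ᵥ
        (x - γ • (γ • (1 : Matrix (Fin p) (Fin p) ℝ) - X)⁻¹ *ᵥ y) := by
  set M := γ • (1 : Matrix (Fin p) (Fin p) ℝ) - X with hM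
  have hX : X = γ • 1 - M := by rw [hM]; abel
  have hdet : IsUnit M.det := h.det_pos.ne'.isUnit
  have hMt : Mᵀ = M := by simpa using h.isHermitian.eq
  have h1 : M *ᵥ M⁻¹ *ᵥ y = y := by rw [mulVec_mulVec, mul_nonsing_inv _ hdet, one_mulVec]
  have h2 : (M⁻¹ *ᵥ y) ⬝ᵥ M *ᵥ x = y ⬝ᵥ x := by
    rw [dotProduct_mulVec, ← mulVec_transpose, hMt, h1]
  have h3 : (M⁻¹ *ᵥ y) ⬝ᵥ y = y ⬝ᵥ M⁻¹ *ᵥ y := dotProduct_comm _ _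
  rw [hX]
  simp only [mulVec_sub, mulVec_smul, sub_mulVec, smul_mulVec, one_mulVec, dotProduct_sub,
    sub_dotProduct, smul_dotProduct, dotProduct_smul, h1, h2, h3, smul_eq_mul,
    dotProduct_comm y x]
  ring

/-- Pointwise form of weak duality. -/
theorem quadratic_le_of_posDef {X : Matrix (Fin p) (Fin p) ℝ} {γ : ℝ}
    (h : (γ • (1 : Matrix (Fin p) (Fin p) ℝ) - X).PosDef) (x y : Fin p → ℝ) :
    x ⬝ᵥ X *ᵥ x ≤ γ * ((x - y) ⬝ᵥ (x - y)) +
      (γ ^ 2 * (y ⬝ᵥ (γ • (1 : Matrix (Fin p) (Fin p) ℝ) - X)⁻¹ *ᵥ y) - γ * (y ⬝ᵥ y)) := by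
  rw [quadratic_eq_of_posDef h x y]
  exact sub_le_self _ (h.posSemidef.dotProduct_mulVec_nonneg _)

/-- Weak duality: `γ` bounds the expected loss of all distributions in the ambiguity set. -/
theorem integral_frobInner_le {S X : Matrix (Fin p) (Fin p) ℝ} {ρ γ : ℝ} (hρ : 0 ≤ ρ)
    (hγ : 0 ≤ γ) (hS : S.PosSemidef) (h : (γ • (1 : Matrix (Fin p) (Fin p) ℝ) - X).PosDef)
    {Q : Measure (EuclideanSpace ℝ (Fin p))} (hQ : Q ∈ ambiguitySet ρ S) :
    ∫ ξ, frobInner (vecMulVec ξ.ofLp ξ.ofLp) X ∂Q ≤ γ * (ρ ^ 2 - S.trace) +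
      γ ^ 2 * frobInner (γ • (1 : Matrix (Fin p) (Fin p) ℝ) - X)⁻¹ S := by
  obtain ⟨⟨T, hT, rfl⟩, hW⟩ := hQ
  simp only [frobInner_vecMulVec]
  set N := (γ • (1 : Matrix (Fin p) (Fin p) ℝ) - X)⁻¹
  -- An optimal coupling need not be at hand: for each `r > ρ` some coupling has cost below `r`, and
  -- `r` decreases to `ρ` at the end.
  have key (r : ℝ) (hr : ρ < r) : ∫ ξ : EuclideanSpace ℝ (Fin p), ξ.ofLp ⬝ᵥ X *ᵥ ξ.ofLp
      ∂(multivariateGaussian 0 T) ≤ γ * r ^ 2 + (γ ^ 2 * (Nᵀ * S).trace - γ * S.trace) := by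
    have hr0 : 0 ≤ r := hρ.trans hr.le
    have hlt : wasserstein (multivariateGaussian 0 T) (multivariateGaussian 0 S) <
        ENNReal.ofReal r := hW.trans_lt ((ENNReal.ofReal_lt_ofReal_iff (hρ.trans_lt hr)).2 hr)
    simp only [wasserstein, iInf_lt_iff] at hlt
    obtain ⟨π, ⟨h1, h2⟩, hπ⟩ := hlt
    have hcost : ∫⁻ z, ‖z.1 - z.2‖ₑ ^ 2 ∂π ≤ ENNReal.ofReal (r ^ 2) := by
      have := ENNReal.rpow_le_rpow hπ.le (z := 2) (by norm_num)
      rw [← ENNReal.rpow_mul] at this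
      simpa [ENNReal.ofReal_pow hr0] using this
    have hd (z : EuclideanSpace ℝ (Fin p) × EuclideanSpace ℝ (Fin p)) :
        ‖z.1 - z.2‖ₑ ^ 2 = ENNReal.ofReal (‖z.1 - z.2‖ ^ 2) := by
      rw [← ofReal_norm, ← ENNReal.ofReal_pow (norm_nonneg _)]
    simp only [hd] at hcost
    have hint : Integrable (fun z => ‖z.1 - z.2‖ ^ 2) π := by
      refine ⟨by fun_prop, ?_⟩
      rw [hasFiniteIntegral_iff_ofReal (.of_forall fun z => by positivity)]
      exact hcost.trans_lt ENNReal.ofReal_lt_top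
    have hcost' : ∫ z, ‖z.1 - z.2‖ ^ 2 ∂π ≤ r ^ 2 := by
      rw [integral_eq_lintegral_of_nonneg_ae (.of_forall fun z => by positivity) (by fun_prop)]
      exact ENNReal.toReal_le_of_le_ofReal (by positivity) hcost
    have hX := integrable_quadratic_of_map_eq measurable_snd h2
    have hi (M : Matrix (Fin p) (Fin p) ℝ) :
        ∫ z, z.2.ofLp ⬝ᵥ M *ᵥ z.2.ofLp ∂π = (Mᵀ * S).trace := by
      rw [integral_quadratic_of_map_eq measurable_snd h2,
        integral_quadratic_multivariateGaussian hS]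
    have hT' := integrable_quadratic_of_map_eq measurable_fst h1 X
    have hN := (hX N).const_mul (γ ^ 2)
    have h1' := (hX 1).const_mul γ
    calc ∫ ξ : EuclideanSpace ℝ (Fin p), ξ.ofLp ⬝ᵥ X *ᵥ ξ.ofLp ∂(multivariateGaussian 0 T)
        = ∫ z, z.1.ofLp ⬝ᵥ X *ᵥ z.1.ofLp ∂π :=
          (integral_quadratic_of_map_eq measurable_fst h1 X).symm
      _ ≤ ∫ z, (γ * ‖z.1 - z.2‖ ^ 2 + (γ ^ 2 * (z.2.ofLp ⬝ᵥ N *ᵥ z.2.ofLp) -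
            γ * (z.2.ofLp ⬝ᵥ 1 *ᵥ z.2.ofLp))) ∂π := by
          refine integral_mono hT' ((hint.const_mul γ).add (hN.sub h1')) fun z => ?_
          simp only [norm_sq_eq_dotProduct, one_mulVec]
          exact quadratic_le_of_posDef h _ _
      _ = γ * (∫ z, ‖z.1 - z.2‖ ^ 2 ∂π) + (γ ^ 2 * (Nᵀ * S).trace - γ * S.trace) := by
          refine (integral_add (hint.const_mul γ) (hN.sub h1')).trans ?_
          simp only [Pi.sub_apply]
          rw [integral_sub hN h1', integral_const_mul, integral_const_mul, integral_const_mul, hi, hi]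
          simp
      _ ≤ _ := by gcongr
  have hlim : Filter.Tendsto (fun r : ℝ => γ * r ^ 2 + (γ ^ 2 * (Nᵀ * S).trace - γ * S.trace))
      (nhdsWithin ρ (Set.Ioi ρ)) (nhds (γ * ρ ^ 2 + (γ ^ 2 * (Nᵀ * S).trace - γ * S.trace))) :=
    (Continuous.tendsto (by fun_prop) ρ).mono_left nhdsWithin_le_nhds
  have := ge_of_tendsto hlim (Filter.eventually_of_mem self_mem_nhdsWithin key)
  rw [frobInner]
  linarith

end Gaussian

/-! ### Strong duality for the quadratic problem on a Frobenius ball -/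

section Duality

variable {p : ℕ}

/-- `l` is the largest eigenvalue of `X`, with the unit eigenvector `u`. -/
structure IsTopEigenpair (X : Matrix (Fin p) (Fin p) ℝ) (l : ℝ) (u : Fin p → ℝ) : Prop where
  dotProduct_self : u ⬝ᵥ u = 1
  mulVec_eq : X *ᵥ u = l • u
  quadratic_le : ∀ v : Fin p → ℝ, v ⬝ᵥ X *ᵥ v ≤ l * (v ⬝ᵥ v)

theorem dotProduct_self_nonneg_real (v : Fin p → ℝ) : 0 ≤ v ⬝ᵥ v := by
  simpa using dotProduct_star_self_nonneg v

/-- The determinant bound sums `log (ε x) ≤ ε x - 1` over the eigenvalues; the free `ε` later makes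
`log det X` cost only a fraction of `l`. -/
theorem exists_isTopEigenpair (hp : 0 < p) {X : Matrix (Fin p) (Fin p) ℝ} (hX : X.PosDef) :
    ∃ l u, IsTopEigenpair X l u ∧
      ∀ ε : ℝ, 0 < ε → Real.log X.det ≤ p * (ε * l - 1 - Real.log ε) := by
  have : Nonempty (Fin p) := ⟨⟨0, hp⟩⟩
  have hH := hX.isHermitian
  obtain ⟨k, hk⟩ := Finite.exists_max hH.eigenvalues
  refine ⟨hH.eigenvalues k, (hH.eigenvectorBasis k).ofLp, ⟨?_, hH.mulVec_eigenvectorBasis k, ?_⟩, ?_⟩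
  · rw [← norm_sq_eq_dotProduct, hH.eigenvectorBasis.orthonormal.1 k, one_pow]
  · intro v
    set b := hH.eigenvectorBasis
    set x : EuclideanSpace ℝ (Fin p) := WithLp.toLp 2 v with hx
    have h1 : v ⬝ᵥ v = ∑ i, inner ℝ (b i) x ^ 2 := by
      rw [b.sum_sq_inner_right, norm_sq_eq_dotProduct]
    have hXt : Xᵀ = X := by simpa using hH.eq
    have h2 : v ⬝ᵥ X *ᵥ v = ∑ i, hH.eigenvalues i * inner ℝ (b i) x ^ 2 := by
      have : v ⬝ᵥ X *ᵥ v = inner ℝ x (WithLp.toLp 2 (X *ᵥ v)) := by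
        rw [real_inner_eq_dotProduct]
      rw [this, ← b.sum_inner_mul_inner]
      refine Finset.sum_congr rfl fun i _ => ?_
      have h3 : inner ℝ (b i) (WithLp.toLp 2 (X *ᵥ v)) = hH.eigenvalues i * inner ℝ (b i) x := by
        rw [real_inner_eq_dotProduct, real_inner_eq_dotProduct, dotProduct_mulVec,
          ← mulVec_transpose, hXt, hH.mulVec_eigenvectorBasis, smul_dotProduct, smul_eq_mul]
      rw [h3, real_inner_comm]
      ring
    rw [h1, h2, Finset.mul_sum]
    exact Finset.sum_le_sum fun i _ => mul_le_mul_of_nonneg_right (hk i) (sq_nonneg _)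
  · intro ε hε
    have hdet : X.det = ∏ i, hH.eigenvalues i := by simpa using hH.det_eq_prod_eigenvalues
    rw [hdet, Real.log_prod fun i _ => (hX.eigenvalues_pos i).ne']
    calc ∑ i, Real.log (hH.eigenvalues i) ≤
        ∑ _i : Fin p, (ε * hH.eigenvalues k - 1 - Real.log ε) := by
          refine Finset.sum_le_sum fun i _ => ?_
          have h1 := Real.log_le_sub_one_of_pos (mul_pos hε (hX.eigenvalues_pos i))
          rw [Real.log_mul hε.ne' (hX.eigenvalues_pos i).ne'] at h1
          have := mul_le_mul_of_nonneg_left (hk i) hε.le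
          linarith
      _ = _ := by simp; ring

theorem IsTopEigenpair.pos {X : Matrix (Fin p) (Fin p) ℝ} {l : ℝ} {u : Fin p → ℝ}
    (h : IsTopEigenpair X l u) (hX : X.PosDef) : 0 < l := by
  have hu : u ≠ 0 := by
    rintro rfl
    simpa using h.dotProduct_self
  have := hX.dotProduct_mulVec_pos hu
  simpa [h.mulVec_eq, h.dotProduct_self] using this

theorem IsTopEigenpair.posDef_iff {X : Matrix (Fin p) (Fin p) ℝ} {l : ℝ} {u : Fin p → ℝ}
    (h : IsTopEigenpair X l u) (hX : X.IsHermitian) {γ : ℝ} :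
    (γ • (1 : Matrix (Fin p) (Fin p) ℝ) - X).PosDef ↔ l < γ := by
  constructor
  · intro hγ
    have hu : u ≠ 0 := by
      rintro rfl
      simpa using h.dotProduct_self
    have := hγ.dotProduct_mulVec_pos hu
    simpa [sub_mulVec, smul_mulVec, h.mulVec_eq, h.dotProduct_self] using this
  · intro hγ
    refine .of_dotProduct_mulVec_pos ((isHermitian_one.smul (IsSelfAdjoint.all γ)).sub hX)
      fun x hx => ?_
    have h1 : 0 < x ⬝ᵥ x := by simpa using dotProduct_star_self_pos_iff.2 hx
    have h2 := h.quadratic_le x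
    simp only [star_trivial, sub_mulVec, smul_mulVec, one_mulVec, dotProduct_sub, dotProduct_smul,
      smul_eq_mul]
    nlinarith

theorem trace_transpose_mul_mul (B M : Matrix (Fin p) (Fin p) ℝ) :
    (Bᵀ * M * B).trace = ∑ j, Bᵀ j ⬝ᵥ M *ᵥ Bᵀ j := by
  rw [Matrix.mul_assoc]
  simp only [trace, diag, Matrix.mul_apply']
  rfl

theorem trace_transpose_mul_self (B : Matrix (Fin p) (Fin p) ℝ) :
    (Bᵀ * B).trace = ∑ j, Bᵀ j ⬝ᵥ Bᵀ j := by
  simp only [trace, diag, Matrix.mul_apply']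
  rfl

theorem trace_transpose_mul_self_nonneg (B : Matrix (Fin p) (Fin p) ℝ) :
    0 ≤ (Bᵀ * B).trace := by
  rw [trace_transpose_mul_self]
  exact Finset.sum_nonneg fun j _ => dotProduct_self_nonneg_real _

theorem IsTopEigenpair.trace_le {X : Matrix (Fin p) (Fin p) ℝ} {l : ℝ} {u : Fin p → ℝ}
    (h : IsTopEigenpair X l u) (B : Matrix (Fin p) (Fin p) ℝ) :
    (Bᵀ * X * B).trace ≤ l * (Bᵀ * B).trace := by
  rw [trace_transpose_mul_mul, trace_transpose_mul_self, Finset.mul_sum]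
  exact Finset.sum_le_sum fun j _ => h.quadratic_le _

/-- The dual objective for a fixed `X`, without its log-determinant term. -/
noncomputable def dualBound (ρ : ℝ) (S X : Matrix (Fin p) (Fin p) ℝ) (γ : ℝ) : ℝ :=
  γ * (ρ ^ 2 - S.trace) + γ ^ 2 * frobInner (γ • (1 : Matrix (Fin p) (Fin p) ℝ) - X)⁻¹ S

/-- The displacement that maximizes the Lagrangian with multiplier `γ`. -/
noncomputable def displacement (X A : Matrix (Fin p) (Fin p) ℝ) (γ : ℝ) :
    Matrix (Fin p) (Fin p) ℝ :=
  γ • (γ • (1 : Matrix (Fin p) (Fin p) ℝ) - X)⁻¹ * A - A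

/-- The square is completed column by column. The displacement cancels the residual, so only `(t * u
j) • u` is left, and `u` is an eigenvector of `γ I - X` for `γ - l`. -/
theorem trace_perturbed {X A : Matrix (Fin p) (Fin p) ℝ} {l : ℝ} {u : Fin p → ℝ}
    (h : IsTopEigenpair X l u) {γ : ℝ} (ρ : ℝ)
    (hγ : (γ • (1 : Matrix (Fin p) (Fin p) ℝ) - X).PosDef) (t : ℝ) :
    ((A + (displacement X A γ + t • vecMulVec u u))ᵀ * X *
        (A + (displacement X A γ + t • vecMulVec u u))).trace =
      dualBound ρ (A * Aᵀ) X γ - (γ - l) * t ^ 2 +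
        γ * (((displacement X A γ + t • vecMulVec u u)ᵀ *
          (displacement X A γ + t • vecMulVec u u)).trace - ρ ^ 2) := by
  set M := γ • (1 : Matrix (Fin p) (Fin p) ℝ) - X with hM
  set D := displacement X A γ + t • vecMulVec u u with hD
  have hNt : (M⁻¹)ᵀ = M⁻¹ := by simpa using hγ.inv.isHermitian.eq
  have h1 : (A * Aᵀ).trace = ∑ j, Aᵀ j ⬝ᵥ Aᵀ j := by
    rw [trace_mul_comm, trace_transpose_mul_self]
  have h2 : frobInner M⁻¹ (A * Aᵀ) = ∑ j, Aᵀ j ⬝ᵥ M⁻¹ *ᵥ Aᵀ j := by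
    rw [frobInner, hNt, ← trace_transpose_mul_mul, ← Matrix.mul_assoc, trace_mul_comm,
      ← Matrix.mul_assoc]
  have hcol (j : Fin p) : (A + D)ᵀ j - γ • M⁻¹ *ᵥ Aᵀ j = (t * u j) • u := by
    ext i
    simp only [hD, displacement, ← hM, transpose_apply, Matrix.add_apply, Matrix.sub_apply,
      Matrix.smul_mul, Matrix.smul_apply, Pi.sub_apply, Pi.smul_apply, smul_eq_mul, vecMulVec_apply,
      mulVec, dotProduct, Matrix.mul_apply]
    ring
  have hMu : M *ᵥ u = (γ - l) • u := by
    rw [hM, sub_mulVec, smul_mulVec, one_mulVec, h.mulVec_eq, sub_smul]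
  have hq (j : Fin p) : ((t * u j) • u) ⬝ᵥ M *ᵥ ((t * u j) • u) = (γ - l) * t ^ 2 * u j ^ 2 := by
    simp only [mulVec_smul, hMu, smul_dotProduct, dotProduct_smul, h.dotProduct_self, smul_eq_mul]
    ring
  have hu : ∑ j, u j ^ 2 = 1 := by
    rw [← h.dotProduct_self]
    simp [dotProduct, sq]
  have hd (j : Fin p) : (A + D)ᵀ j - Aᵀ j = Dᵀ j := by
    ext i
    simp
  rw [trace_transpose_mul_mul, Finset.sum_congr rfl fun j _ =>
    quadratic_eq_of_posDef hγ ((A + D)ᵀ j) (Aᵀ j)]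
  simp only [← hM, hcol, hq, hd]
  rw [Finset.sum_sub_distrib, Finset.sum_add_distrib, Finset.sum_sub_distrib, ← Finset.mul_sum,
    ← Finset.mul_sum, ← Finset.mul_sum, ← Finset.mul_sum, hu, dualBound, ← hM, h1, h2,
    trace_transpose_mul_self]
  ring

theorem trace_displacement_add {u : Fin p → ℝ} (hu : u ⬝ᵥ u = 1) (D : Matrix (Fin p) (Fin p) ℝ)
    (t : ℝ) : ((D + t • vecMulVec u u)ᵀ * (D + t • vecMulVec u u)).trace =
      (Dᵀ * D).trace + 2 * t * (u ⬝ᵥ D *ᵥ u) + t ^ 2 := by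
  have h1 : (Dᵀ * vecMulVec u u).trace = u ⬝ᵥ D *ᵥ u := by
    rw [mul_vecMulVec, trace_vecMulVec, mulVec_transpose, dotProduct_mulVec]
  have h2 : (vecMulVec u u * D).trace = u ⬝ᵥ D *ᵥ u := by
    rw [vecMulVec_mul, trace_vecMulVec, dotProduct_comm, dotProduct_mulVec]
  have h3 : (vecMulVec u u * vecMulVec u u).trace = 1 := by
    rw [vecMulVec_mul, trace_vecMulVec, vecMul_vecMulVec, hu]
    simp [hu]
  simp only [transpose_add, transpose_smul, transpose_vecMulVec, Matrix.add_mul, Matrix.mul_add,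
    Matrix.smul_mul, Matrix.mul_smul, trace_add, trace_smul, h1, h2, h3, smul_eq_mul]
  ring

/-- The root of smaller modulus is taken: the roots have product `a - R`, hence its square is at
most `R - a`. -/
theorem exists_quadratic_eq {a R : ℝ} (ha : 0 ≤ a) (haR : a ≤ R) (c : ℝ) :
    ∃ t : ℝ, a + 2 * t * c + t ^ 2 = R ∧ t ^ 2 ≤ R := by
  have hs := Real.sq_sqrt (show 0 ≤ c ^ 2 + (R - a) by nlinarith [sq_nonneg c])
  set s := √(c ^ 2 + (R - a))
  have hs0 : |c| ≤ s := Real.abs_le_sqrt (by linarith)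
  rcases le_total 0 c with hc | hc
  · rw [abs_of_nonneg hc] at hs0
    exact ⟨s - c, by nlinarith, by nlinarith⟩
  · rw [abs_of_nonpos hc] at hs0
    exact ⟨-s - c, by nlinarith, by nlinarith⟩

theorem continuousAt_matrix_inv_of_det_ne_zero {M : Matrix (Fin p) (Fin p) ℝ} (h : M.det ≠ 0) :
    ContinuousAt Inv.inv M := by
  refine continuousAt_matrix_inv M ?_
  rw [Ring.inverse_eq_inv']
  exact continuousAt_inv₀ h

theorem continuousOn_trace_displacement (X A : Matrix (Fin p) (Fin p) ℝ) {s : Set ℝ}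
    (hs : ∀ γ ∈ s, (γ • (1 : Matrix (Fin p) (Fin p) ℝ) - X).PosDef) :
    ContinuousOn (fun γ => ((displacement X A γ)ᵀ * displacement X A γ).trace) s := by
  have hD : ContinuousOn (displacement X A) s := by
    intro γ hγ
    refine ContinuousAt.continuousWithinAt ?_
    have : ContinuousAt (fun γ : ℝ => (γ • (1 : Matrix (Fin p) (Fin p) ℝ) - X)⁻¹) γ :=
      ContinuousAt.comp (f := fun γ : ℝ => γ • (1 : Matrix (Fin p) (Fin p) ℝ) - X)
        (continuousAt_matrix_inv_of_det_ne_zero (hs γ hγ).det_pos.ne')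
        (Continuous.continuousAt (by fun_prop))
    unfold displacement
    fun_prop
  have hT : Continuous fun D : Matrix (Fin p) (Fin p) ℝ => (Dᵀ * D).trace := by fun_prop
  exact hT.comp_continuousOn hD

/-- With `s = γ⁻¹`, the matrix `γ (γ I - X)⁻¹` becomes `(I - s X)⁻¹`, which is continuous at `s = 0`
with value `I`. -/
theorem tendsto_trace_displacement (X A : Matrix (Fin p) (Fin p) ℝ) :
    Filter.Tendsto (fun γ => ((displacement X A γ)ᵀ * displacement X A γ).trace)
      Filter.atTop (nhds 0) := by
  have hc : ContinuousAt (fun s : ℝ => (((1 - s • X)⁻¹ * A - A)ᵀ * ((1 - s • X)⁻¹ * A - A)).trace)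
      0 := by
    have h1 : ContinuousAt (fun s : ℝ => (1 - s • X)⁻¹) 0 :=
      ContinuousAt.comp (f := fun s : ℝ => 1 - s • X)
        (continuousAt_matrix_inv_of_det_ne_zero (by simp))
        (Continuous.continuousAt (by fun_prop))
    have hT : Continuous fun D : Matrix (Fin p) (Fin p) ℝ => ((D * A - A)ᵀ * (D * A - A)).trace := by
      fun_prop
    exact hT.continuousAt.comp h1
  have h2 := hc.tendsto.comp tendsto_inv_atTop_zero
  simp only [zero_smul, sub_zero, inv_one, Matrix.one_mul, sub_self, Matrix.mul_zero,
    trace_zero] at h2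
  refine h2.congr' ?_
  have hdet : ∀ᶠ γ : ℝ in Filter.atTop, (1 - γ⁻¹ • X).det ≠ 0 := by
    have hcont : Continuous fun s : ℝ => (1 - s • X).det := by fun_prop
    have := (hcont.tendsto 0).comp tendsto_inv_atTop_zero
    exact this.eventually_ne (by simp)
  filter_upwards [Filter.eventually_gt_atTop 0, hdet] with γ hγ hγdet
  have : γ • (γ • (1 : Matrix (Fin p) (Fin p) ℝ) - X)⁻¹ = (1 - γ⁻¹ • X)⁻¹ := by
    have h3 : γ • (1 : Matrix (Fin p) (Fin p) ℝ) - X = γ • (1 - γ⁻¹ • X) := by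
      rw [smul_sub, smul_inv_smul₀ hγ.ne']
    rw [h3, show γ • (1 - γ⁻¹ • X) = Units.mk0 γ hγ.ne' • (1 - γ⁻¹ • X) from rfl,
      inv_smul' _ _ hγdet.isUnit, Units.smul_def, smul_smul]
    simp [hγ.ne']
  simp only [Function.comp, displacement, this]

/-- Strong duality, up to an arbitrarily small error. -/
theorem exists_trace_ge_dualBound {X : Matrix (Fin p) (Fin p) ℝ} {l : ℝ} {u : Fin p → ℝ}
    (h : IsTopEigenpair X l u) (hX : X.IsHermitian) (A : Matrix (Fin p) (Fin p) ℝ) {ρ ε : ℝ}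
    (hρ : 0 < ρ) (hε : 0 < ε) :
    ∃ γ : ℝ, l < γ ∧ ∃ D : Matrix (Fin p) (Fin p) ℝ, (Dᵀ * D).trace ≤ ρ ^ 2 ∧
      dualBound ρ (A * Aᵀ) X γ - ε ≤ ((A + D)ᵀ * X * (A + D)).trace := by
  by_cases hall : ∀ γ, l < γ → ((displacement X A γ)ᵀ * displacement X A γ).trace ≤ ρ ^ 2
  -- The hard case: the displacement never leaves the ball. Take `γ` just above `l` and add a
  -- multiple of `u uᵀ` to reach norm `ρ`; the loss `(γ - l) t²` is at most `ε`.
  · have hpos : 0 < ε / ρ ^ 2 := by positivity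
    have hl : l < l + ε / ρ ^ 2 := by linarith
    obtain ⟨t, ht, htR⟩ := exists_quadratic_eq (trace_transpose_mul_self_nonneg _)
      (hall _ hl) (u ⬝ᵥ displacement X A (l + ε / ρ ^ 2) *ᵥ u)
    have hn := trace_displacement_add h.dotProduct_self (displacement X A (l + ε / ρ ^ 2)) t
    rw [ht] at hn
    refine ⟨_, hl, _, hn.le, ?_⟩
    rw [trace_perturbed h ρ ((h.posDef_iff hX).2 hl), hn]
    have : ε / ρ ^ 2 * t ^ 2 ≤ ε / ρ ^ 2 * ρ ^ 2 := by gcongr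
    rw [div_mul_cancel₀ _ (by positivity)] at this
    linarith
  -- Otherwise the displacement norm crosses `ρ` at some `γ`; complementary slackness then holds
  -- there and the gap is zero.
  · push Not at hall
    obtain ⟨γ₀, hγ₀, h0⟩ := hall
    obtain ⟨γ₁, h1, h01⟩ := (((tendsto_trace_displacement X A).eventually_lt_const
      (show (0 : ℝ) < ρ ^ 2 by positivity)).and (Filter.eventually_ge_atTop γ₀)).exists
    have hc := continuousOn_trace_displacement X A (s := Set.Icc γ₀ γ₁)
      fun γ hγ => (h.posDef_iff hX).2 (hγ₀.trans_le hγ.1)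
    obtain ⟨γ, hγ, hγρ⟩ := intermediate_value_Icc' h01 hc ⟨h1.le, h0.le⟩
    replace hγρ : ((displacement X A γ)ᵀ * displacement X A γ).trace = ρ ^ 2 := hγρ
    have hl : l < γ := hγ₀.trans_le hγ.1
    refine ⟨γ, hl, displacement X A γ, hγρ.le, ?_⟩
    have := trace_perturbed h ρ ((h.posDef_iff hX).2 hl) (A := A) 0
    simp only [zero_smul, add_zero] at this
    rw [this, hγρ]
    linarith

end Duality

/-! ### Reduction of the worst-case loss to matrices -/

section WorstCase

variable {p : ℕ}

/-- The values of `Tr(Bᵀ X B)` on the Frobenius ball of radius `ρ` around `A`. -/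
def quadValues (ρ : ℝ) (X A : Matrix (Fin p) (Fin p) ℝ) : Set ℝ :=
  {r | ∃ D : Matrix (Fin p) (Fin p) ℝ, (Dᵀ * D).trace ≤ ρ ^ 2 ∧
    r = ((A + D)ᵀ * X * (A + D)).trace}

/-- The maximum of `Tr(Bᵀ X B)` over the Frobenius ball of radius `ρ` around `A`. -/
noncomputable def maxQuad (ρ : ℝ) (X A : Matrix (Fin p) (Fin p) ℝ) : ℝ :=
  sSup (quadValues ρ X A)

theorem exists_mem_ambiguitySet {ρ r : ℝ} (hρ : 0 ≤ ρ) {X A : Matrix (Fin p) (Fin p) ℝ}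
    (hX : X.IsHermitian) (hr : r ∈ quadValues ρ X A) :
    ∃ Q ∈ ambiguitySet ρ (A * Aᵀ), ∫ ξ, frobInner (vecMulVec ξ.ofLp ξ.ofLp) X ∂Q = r := by
  obtain ⟨D, hD, rfl⟩ := hr
  have hB : ((A + D) * (A + D)ᵀ).PosSemidef := by
    simpa using posSemidef_self_mul_conjTranspose (A + D)
  have hXt : Xᵀ = X := by simpa using hX.eq
  refine ⟨multivariateGaussian 0 ((A + D) * (A + D)ᵀ), ⟨⟨_, hB, rfl⟩,
    wasserstein_le_of_trace_le hρ rfl (by simpa using hD)⟩, ?_⟩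
  simp only [frobInner_vecMulVec]
  rw [integral_quadratic_multivariateGaussian hB, hXt, ← Matrix.mul_assoc, trace_mul_comm,
    ← Matrix.mul_assoc]

theorem posSemidef_mul_transpose_self (A : Matrix (Fin p) (Fin p) ℝ) : (A * Aᵀ).PosSemidef := by
  simpa using posSemidef_self_mul_conjTranspose A

/-- Each value on the ball is the expected loss of a law in the ambiguity set, so the probabilistic
bound covers it. -/
theorem le_dualBound {ρ r γ : ℝ} (hρ : 0 ≤ ρ) (hγ : 0 ≤ γ) {X A : Matrix (Fin p) (Fin p) ℝ}
    (hX : X.IsHermitian) (h : (γ • (1 : Matrix (Fin p) (Fin p) ℝ) - X).PosDef)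
    (hr : r ∈ quadValues ρ X A) : r ≤ dualBound ρ (A * Aᵀ) X γ := by
  obtain ⟨Q, hQ, rfl⟩ := exists_mem_ambiguitySet hρ hX hr
  exact integral_frobInner_le hρ hγ (posSemidef_mul_transpose_self A) h hQ

theorem quadValues_nonempty (ρ : ℝ) (X A : Matrix (Fin p) (Fin p) ℝ) :
    (quadValues ρ X A).Nonempty :=
  ⟨_, 0, by simpa using sq_nonneg ρ, rfl⟩

variable {X : Matrix (Fin p) (Fin p) ℝ} {l : ℝ} {u : Fin p → ℝ}

theorem IsTopEigenpair.bddAbove_quadValues (h : IsTopEigenpair X l u) (hX : X.PosDef) {ρ : ℝ}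
    (hρ : 0 ≤ ρ) (A : Matrix (Fin p) (Fin p) ℝ) : BddAbove (quadValues ρ X A) :=
  ⟨dualBound ρ (A * Aᵀ) X (l + 1), fun _ hr => le_dualBound hρ (by linarith [h.pos hX])
    hX.isHermitian ((h.posDef_iff hX.isHermitian).2 (by linarith)) hr⟩

theorem IsTopEigenpair.maxQuad_le_dualBound (h : IsTopEigenpair X l u) (hX : X.PosDef) {ρ γ : ℝ}
    (hρ : 0 ≤ ρ) (A : Matrix (Fin p) (Fin p) ℝ) (hγ : l < γ) :
    maxQuad ρ X A ≤ dualBound ρ (A * Aᵀ) X γ :=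
  csSup_le (quadValues_nonempty ρ X A) fun _ hr => le_dualBound hρ ((h.pos hX).trans hγ).le
    hX.isHermitian ((h.posDef_iff hX.isHermitian).2 hγ) hr

theorem IsTopEigenpair.exists_dualBound_le (h : IsTopEigenpair X l u) (hX : X.PosDef) {ρ ε : ℝ}
    (hρ : 0 < ρ) (hε : 0 < ε) (A : Matrix (Fin p) (Fin p) ℝ) :
    ∃ γ, l < γ ∧ dualBound ρ (A * Aᵀ) X γ ≤ maxQuad ρ X A + ε := by
  obtain ⟨γ, hγ, D, hD, hle⟩ := exists_trace_ge_dualBound h hX.isHermitian A hρ hε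
  have := le_csSup (h.bddAbove_quadValues hX hρ.le A) ⟨D, hD, rfl⟩
  exact ⟨γ, hγ, by rw [maxQuad]; linarith⟩

theorem IsTopEigenpair.iSup_ambiguitySet (h : IsTopEigenpair X l u) (hX : X.PosDef) {ρ : ℝ}
    (hρ : 0 < ρ) (A : Matrix (Fin p) (Fin p) ℝ) :
    ⨆ Q ∈ ambiguitySet ρ (A * Aᵀ),
      ((∫ ξ, frobInner (vecMulVec ξ.ofLp ξ.ofLp) X ∂Q : ℝ) : EReal) = (maxQuad ρ X A : ℝ) := by
  apply le_antisymm
  · refine iSup₂_le fun Q hQ => EReal.coe_le_coe_iff.2 (le_of_forall_pos_le_add fun ε hε => ?_)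
    obtain ⟨γ, hγ, hle⟩ := h.exists_dualBound_le hX hρ hε A
    exact (integral_frobInner_le hρ.le ((h.pos hX).trans hγ).le (posSemidef_mul_transpose_self A)
      ((h.posDef_iff hX.isHermitian).2 hγ) hQ).trans hle
  · by_contra! hlt
    obtain ⟨c, hc, hcm⟩ := EReal.lt_iff_exists_real_btwn.1 hlt
    obtain ⟨r, hr, hcr⟩ := exists_lt_of_lt_csSup (quadValues_nonempty ρ X A)
      (EReal.coe_lt_coe_iff.1 hcm)
    obtain ⟨Q, hQ, rfl⟩ := exists_mem_ambiguitySet hρ.le hX.isHermitian hr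
    exact (hc.trans (EReal.coe_lt_coe_iff.2 hcr)).not_ge (le_iSup₂_of_le Q hQ le_rfl)

section Sqrt

open scoped MatrixOrder

/-- The positive semidefinite square root of a matrix. -/
noncomputable def psdSqrt (S : Matrix (Fin p) (Fin p) ℝ) : Matrix (Fin p) (Fin p) ℝ :=
  CFC.sqrt S

theorem psdSqrt_mul_transpose {S : Matrix (Fin p) (Fin p) ℝ} (hS : S.PosSemidef) :
    psdSqrt S * (psdSqrt S)ᵀ = S := by
  have h1 : (psdSqrt S)ᵀ = psdSqrt S := by
    simpa [psdSqrt] using (nonneg_iff_posSemidef.1 (CFC.sqrt_nonneg S)).isHermitian.eq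
  rw [h1]
  exact CFC.sqrt_mul_sqrt_self S hS.nonneg

-- Continuity includes singular matrices, so it serves on the whole cone.
open scoped Matrix.Norms.L2Operator in
theorem continuousOn_psdSqrt :
    ContinuousOn (psdSqrt : Matrix (Fin p) (Fin p) ℝ → Matrix (Fin p) (Fin p) ℝ)
      {S | S.PosSemidef} := by
  have := CFC.continuousOn_sqrt (A := Matrix (Fin p) (Fin p) ℝ)
  simp only [nonneg_iff_posSemidef] at this
  exact this

end Sqrt

/-- The worst-case loss in finite-dimensional form. -/
noncomputable def realLoss (ρ : ℝ) (S X : Matrix (Fin p) (Fin p) ℝ) : ℝ :=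
  -Real.log X.det + maxQuad ρ X (psdSqrt S)

theorem worstCaseLoss_eq_realLoss (hp : 0 < p) (hX : X.PosDef) {ρ : ℝ} (hρ : 0 < ρ)
    {S : Matrix (Fin p) (Fin p) ℝ} (hS : S.PosSemidef) :
    worstCaseLoss ρ S X = (realLoss ρ S X : ℝ) := by
  obtain ⟨l, u, h, -⟩ := exists_isTopEigenpair hp hX
  have := h.iSup_ambiguitySet hX hρ (psdSqrt S)
  rw [psdSqrt_mul_transpose hS] at this
  rw [worstCaseLoss, this, realLoss, EReal.coe_add]

theorem iInf_convexObjective_eq_realLoss (hp : 0 < p) (hX : X.PosDef) {ρ : ℝ} (hρ : 0 < ρ)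
    {S : Matrix (Fin p) (Fin p) ℝ} (hS : S.PosSemidef) :
    ⨅ (γ : ℝ) (_ : (γ • (1 : Matrix (Fin p) (Fin p) ℝ) - X).PosDef),
      ((convexObjective ρ S X γ : ℝ) : EReal) = (realLoss ρ S X : ℝ) := by
  obtain ⟨l, u, h, -⟩ := exists_isTopEigenpair hp hX
  have hobj (γ : ℝ) : convexObjective ρ S X γ = -Real.log X.det +
      dualBound ρ (psdSqrt S * (psdSqrt S)ᵀ) X γ := by
    rw [psdSqrt_mul_transpose hS, convexObjective, dualBound]
    ring
  apply le_antisymm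
  · by_contra! hlt
    obtain ⟨c, hcm, hc⟩ := EReal.lt_iff_exists_real_btwn.1 hlt
    have hcm := EReal.coe_lt_coe_iff.1 hcm
    obtain ⟨γ, hγ, hle⟩ := h.exists_dualBound_le hX hρ (sub_pos.2 hcm) (psdSqrt S)
    refine hc.not_ge (iInf₂_le_of_le γ ((h.posDef_iff hX.isHermitian).2 hγ) ?_)
    rw [EReal.coe_le_coe_iff, hobj]
    rw [realLoss] at hle
    linarith
  · refine le_iInf₂ fun γ hγ => EReal.coe_le_coe_iff.2 ?_
    rw [hobj, realLoss]
    have := h.maxQuad_le_dualBound hX hρ.le (psdSqrt S) ((h.posDef_iff hX.isHermitian).1 hγ)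
    linarith

end WorstCase

/-! ### Estimates uniform in `X`, and continuity of the optimal value -/

section Continuity

variable {p : ℕ} {X : Matrix (Fin p) (Fin p) ℝ} {l : ℝ} {u : Fin p → ℝ}

/-- Young's inequality with weight `d`, from nonnegativity of the form at `d B - E`. -/
theorem trace_add_le (hX : X.PosSemidef) (B E : Matrix (Fin p) (Fin p) ℝ) {d : ℝ} (hd : 0 < d) :
    ((B + E)ᵀ * X * (B + E)).trace ≤
      (1 + d) * (Bᵀ * X * B).trace + (1 + d⁻¹) * (Eᵀ * X * E).trace := by
  have h0 : 0 ≤ ((d • B - E)ᵀ * X * (d • B - E)).trace := by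
    rw [trace_transpose_mul_mul]
    exact Finset.sum_nonneg fun j _ => hX.dotProduct_mulVec_nonneg _
  simp only [transpose_add, transpose_sub, transpose_smul, Matrix.add_mul, Matrix.mul_add,
    Matrix.sub_mul, Matrix.mul_sub, Matrix.smul_mul, Matrix.mul_smul, trace_add, trace_sub,
    trace_smul, smul_eq_mul] at h0 ⊢
  have h1 := mul_nonneg (inv_nonneg.2 hd.le) h0
  field_simp at h1 ⊢
  nlinarith

/-- Averaging over the displacements `± ρ u uᵀ` cancels the cross terms and leaves `Tr(Aᵀ X A) + l
ρ²`. -/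
theorem IsTopEigenpair.mul_sq_le_maxQuad (h : IsTopEigenpair X l u) (hX : X.PosDef) {ρ : ℝ}
    (hρ : 0 ≤ ρ) (A : Matrix (Fin p) (Fin p) ℝ) : l * ρ ^ 2 ≤ maxQuad ρ X A := by
  have hb := h.bddAbove_quadValues hX hρ A
  have hn (t : ℝ) : ((t • vecMulVec u u)ᵀ * (t • vecMulVec u u)).trace = t ^ 2 := by
    simpa using trace_displacement_add h.dotProduct_self 0 t
  have h1 := le_csSup hb ⟨ρ • vecMulVec u u, (hn ρ).le, rfl⟩
  have h2 := le_csSup hb ⟨(-ρ) • vecMulVec u u, (by rw [hn, neg_sq]), rfl⟩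
  have h3 : (vecMulVec u u * X * vecMulVec u u).trace = l := by
    rw [Matrix.mul_assoc, mul_vecMulVec, h.mulVec_eq, vecMulVec_mul_vecMulVec, trace_vecMulVec]
    simp [h.dotProduct_self]
  have h4 : 0 ≤ (Aᵀ * X * A).trace := by
    rw [trace_transpose_mul_mul]
    exact Finset.sum_nonneg fun j _ => hX.posSemidef.dotProduct_mulVec_nonneg _
  rw [maxQuad]
  simp only [transpose_add, transpose_smul, transpose_vecMulVec, Matrix.add_mul, Matrix.mul_add,
    Matrix.smul_mul, Matrix.mul_smul, trace_add, trace_smul, smul_eq_mul, h3] at h1 h2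
  nlinarith

/-- Multiplicative continuity of `maxQuad` in the centre of the ball, uniform in `X`. -/
theorem IsTopEigenpair.maxQuad_le_mul (h : IsTopEigenpair X l u) (hX : X.PosDef) {ρ d : ℝ}
    (hρ : 0 ≤ ρ) (hd : 0 < d) {A A' : Matrix (Fin p) (Fin p) ℝ}
    (hA : ((A - A')ᵀ * (A - A')).trace ≤ (ρ * d) ^ 2) :
    maxQuad ρ X A ≤ (1 + d) ^ 2 * maxQuad ρ X A' := by
  refine csSup_le (quadValues_nonempty ρ X A) ?_
  rintro _ ⟨D, hD, rfl⟩
  have h1 := trace_add_le hX.posSemidef (A' + D) (A - A') hd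
  rw [show A' + D + (A - A') = A + D by abel] at h1
  have h2 : ((A' + D)ᵀ * X * (A' + D)).trace ≤ maxQuad ρ X A' :=
    le_csSup (h.bddAbove_quadValues hX hρ A') ⟨D, hD, rfl⟩
  -- The shift costs at most `l (ρ d)²`, and `l ρ²` is itself at most `maxQuad`.
  have h3 : ((A - A')ᵀ * X * (A - A')).trace ≤ d ^ 2 * maxQuad ρ X A' := by
    have h4 := mul_le_mul_of_nonneg_left hA (h.pos hX).le
    have h5 := mul_le_mul_of_nonneg_left (h.mul_sq_le_maxQuad hX hρ A') (sq_nonneg d)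
    have := h.trace_le (A - A')
    nlinarith
  calc _ ≤ _ := h1
    _ ≤ (1 + d) * maxQuad ρ X A' + (1 + d⁻¹) * (d ^ 2 * maxQuad ρ X A') := by gcongr
    _ = _ := by field_simp; ring

/-- The worst-case loss controls its trace part, uniformly in `X`. -/
theorem exists_maxQuad_le (hp : 0 < p) {ρ : ℝ} (hρ : 0 < ρ) :
    ∃ C : ℝ, ∀ S X : Matrix (Fin p) (Fin p) ℝ, X.PosDef →
      0 ≤ maxQuad ρ X (psdSqrt S) ∧ maxQuad ρ X (psdSqrt S) ≤ 2 * realLoss ρ S X + C := by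
  have hp' : (0 : ℝ) < p := by exact_mod_cast hp
  refine ⟨-2 * (p * (1 + Real.log (ρ ^ 2 / (2 * p)))), fun S X hX => ?_⟩
  obtain ⟨l, u, h, hlog⟩ := exists_isTopEigenpair hp hX
  have h1 := h.mul_sq_le_maxQuad hX hρ.le (psdSqrt S)
  refine ⟨le_trans (mul_nonneg (h.pos hX).le (sq_nonneg ρ)) h1, ?_⟩
  -- This `ε` makes the linear term `l ρ² / 2`, at most half of `maxQuad`.
  have h2 := hlog (ρ ^ 2 / (2 * p)) (by positivity)
  have h3 : p * (ρ ^ 2 / (2 * p) * l - 1 - Real.log (ρ ^ 2 / (2 * p))) =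
      l * ρ ^ 2 / 2 - p * (1 + Real.log (ρ ^ 2 / (2 * p))) := by
    field_simp
    ring
  rw [h3] at h2
  rw [realLoss]
  linarith

/-- The optimal value as a real number. -/
noncomputable def realValue (ρ : ℝ) (𝒳 : Set (Matrix (Fin p) (Fin p) ℝ))
    (S : Matrix (Fin p) (Fin p) ℝ) : ℝ :=
  sInf (realLoss ρ S '' 𝒳)

variable {𝒳 : Set (Matrix (Fin p) (Fin p) ℝ)} {ρ : ℝ}

theorem bddBelow_realLoss (hp : 0 < p) (hρ : 0 < ρ) (h𝒳 : ∀ X ∈ 𝒳, X.PosDef)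
    (S : Matrix (Fin p) (Fin p) ℝ) : BddBelow (realLoss ρ S '' 𝒳) := by
  obtain ⟨C, hC⟩ := exists_maxQuad_le hp hρ
  refine ⟨-C / 2, ?_⟩
  rintro _ ⟨X, hX, rfl⟩
  linarith [hC S X (h𝒳 X hX)]

theorem droValue_eq_realValue (hp : 0 < p) (hρ : 0 < ρ) (h𝒳 : ∀ X ∈ 𝒳, X.PosDef)
    (hne : 𝒳.Nonempty) {S : Matrix (Fin p) (Fin p) ℝ} (hS : S.PosSemidef) :
    droValue ρ 𝒳 S = (realValue ρ 𝒳 S : ℝ) := by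
  have h1 : droValue ρ 𝒳 S = ⨅ X ∈ 𝒳, ((realLoss ρ S X : ℝ) : EReal) :=
    iInf_congr fun X => iInf_congr fun hX => worstCaseLoss_eq_realLoss hp (h𝒳 X hX) hρ hS
  rw [h1]
  apply le_antisymm
  · by_contra! hlt
    obtain ⟨c, hcm, hc⟩ := EReal.lt_iff_exists_real_btwn.1 hlt
    obtain ⟨_, ⟨X, hX, rfl⟩, hXc⟩ :=
      exists_lt_of_csInf_lt (hne.image _) (EReal.coe_lt_coe_iff.1 hcm)
    exact hc.not_ge (iInf₂_le_of_le X hX (EReal.coe_le_coe_iff.2 hXc.le))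
  · exact le_iInf₂ fun X hX => EReal.coe_le_coe_iff.2
      (csInf_le (bddBelow_realLoss hp hρ h𝒳 S) ⟨X, hX, rfl⟩)

/-- For each `X`, passing from `S` to `S'` lowers the loss by at most `θ * maxQuad`, hence by at
most `θ (2 * realLoss + C)` at `S`. Only `1 - 2 θ ≥ 0` is needed to take infima. -/
theorem realValue_ge (hp : 0 < p) (hρ : 0 < ρ) (h𝒳 : ∀ X ∈ 𝒳, X.PosDef)
    (hne : 𝒳.Nonempty) {C θ d : ℝ} {S S' : Matrix (Fin p) (Fin p) ℝ}
    (hC : ∀ X ∈ 𝒳, maxQuad ρ X (psdSqrt S) ≤ 2 * realLoss ρ S X + C) (hd : 0 < d)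
    (hθ : θ = 1 - ((1 + d) ^ 2)⁻¹) (hθ' : θ ≤ 1 / 2)
    (hS : ((psdSqrt S - psdSqrt S')ᵀ * (psdSqrt S - psdSqrt S')).trace ≤ (ρ * d) ^ 2) :
    (1 - 2 * θ) * realValue ρ 𝒳 S - θ * C ≤ realValue ρ 𝒳 S' := by
  refine le_csInf (hne.image _) ?_
  rintro _ ⟨X, hX, rfl⟩
  obtain ⟨l, u, h, -⟩ := exists_isTopEigenpair hp (h𝒳 X hX)
  have h1 := h.maxQuad_le_mul (h𝒳 X hX) hρ.le hd hS
  have h2 : realValue ρ 𝒳 S ≤ realLoss ρ S X :=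
    csInf_le (bddBelow_realLoss hp hρ h𝒳 S) ⟨X, hX, rfl⟩
  have h3 : (1 - θ) * maxQuad ρ X (psdSqrt S) ≤ maxQuad ρ X (psdSqrt S') := by
    rw [hθ, sub_sub_cancel]
    exact (inv_mul_le_iff₀ (by positivity)).2 h1
  have hθ0 : 0 ≤ θ := by
    rw [hθ, sub_nonneg]
    exact inv_le_one_of_one_le₀ (by nlinarith)
  have h4 := mul_le_mul_of_nonneg_left (hC X hX) hθ0
  have h5 := mul_le_mul_of_nonneg_left h2 (show 0 ≤ 1 - 2 * θ by linarith)
  have h6 : realLoss ρ S' X - realLoss ρ S X =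
      maxQuad ρ X (psdSqrt S') - maxQuad ρ X (psdSqrt S) := by
    rw [realLoss, realLoss]
    ring
  linarith

theorem continuousOn_realValue (hp : 0 < p) (hρ : 0 < ρ) (h𝒳 : ∀ X ∈ 𝒳, X.PosDef)
    (hne : 𝒳.Nonempty) : ContinuousOn (realValue ρ 𝒳) {S | S.PosSemidef} := by
  obtain ⟨C, hC⟩ := exists_maxQuad_le hp hρ
  intro S hS
  have hclose (d : ℝ) (hd : 0 < d) : ∀ᶠ S' in nhdsWithin S {S | S.PosSemidef},
      ((psdSqrt S - psdSqrt S')ᵀ * (psdSqrt S - psdSqrt S')).trace ≤ (ρ * d) ^ 2 := by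
    have hT : Continuous fun B : Matrix (Fin p) (Fin p) ℝ =>
        ((psdSqrt S - B)ᵀ * (psdSqrt S - B)).trace := by fun_prop
    have := (hT.tendsto _).comp (continuousOn_psdSqrt S hS)
    simp only [sub_self, transpose_zero, Matrix.mul_zero, trace_zero] at this
    exact this.eventually_le_const (by positivity)
  let θ : ℝ → ℝ := fun d => 1 - ((1 + d) ^ 2)⁻¹
  have hθ : Filter.Tendsto θ (nhdsWithin 0 (Set.Ioi 0)) (nhds 0) := by
    have : ContinuousAt θ 0 := by
      refine continuousAt_const.sub (ContinuousAt.inv₀ (by fun_prop) (by norm_num))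
    have h := this.tendsto
    simp only [θ, add_zero, one_pow, inv_one, sub_self] at h
    exact h.mono_left nhdsWithin_le_nhds
  have hθ2 : ∀ᶠ d in nhdsWithin (0 : ℝ) (Set.Ioi 0), 0 < d ∧ θ d ≤ 1 / 4 :=
    (Filter.eventually_of_mem self_mem_nhdsWithin fun _ h => h).and
      (hθ.eventually_le_const (by norm_num))
  refine tendsto_order.2 ⟨fun a ha => ?_, fun b hb => ?_⟩
  · have hlim : Filter.Tendsto (fun d => (1 - 2 * θ d) * realValue ρ 𝒳 S - θ d * C)
        (nhdsWithin 0 (Set.Ioi 0)) (nhds (realValue ρ 𝒳 S)) := by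
      simpa using (((hθ.const_mul 2).const_sub 1).mul_const (realValue ρ 𝒳 S)).sub
        (hθ.mul_const C)
    obtain ⟨d, hda, hd, hd4⟩ := ((hlim.eventually_const_lt ha).and hθ2).exists
    filter_upwards [hclose d hd] with S' hS'
    exact hda.trans_le (realValue_ge hp hρ h𝒳 hne (fun X hX => (hC S X (h𝒳 X hX)).2) hd rfl
      (by linarith) hS')
  -- For the upper bound `S` and `S'` trade places; this works because `C` does not depend on the
  -- matrix.
  · have hlim : Filter.Tendsto (fun d => (1 - 2 * θ d) * b - θ d * C)
        (nhdsWithin 0 (Set.Ioi 0)) (nhds b) := by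
      simpa using (((hθ.const_mul 2).const_sub 1).mul_const b).sub (hθ.mul_const C)
    obtain ⟨d, hdb, hd, hd4⟩ := ((hlim.eventually_const_lt hb).and hθ2).exists
    filter_upwards [hclose d hd] with S' hS'
    rw [← neg_sub (psdSqrt S'), transpose_neg, neg_mul_neg] at hS'
    have := realValue_ge hp hρ h𝒳 hne (fun X hX => (hC S' X (h𝒳 X hX)).2) hd rfl
      (by linarith) hS'
    by_contra! hlt
    have := mul_le_mul_of_nonneg_left hlt (show 0 ≤ 1 - 2 * θ d by linarith)
    simp only [θ] at *
    linarith

end Continuity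

end WassersteinShrinkage

theorem theorem2p5 {p : ℕ} (hp : 0 < p) (ρ : ℝ) (hρ : 0 < ρ)
    (𝒳 : Set (Matrix (Fin p) (Fin p) ℝ)) (h𝒳 : ∀ X ∈ 𝒳, X.PosDef) :
    (∀ S : Matrix (Fin p) (Fin p) ℝ, S.PosSemidef →
      WassersteinShrinkage.droValue ρ 𝒳 S = WassersteinShrinkage.convexValue ρ 𝒳 S ∧
      (∀ X ∈ 𝒳, WassersteinShrinkage.worstCaseLoss ρ S X =
        ⨅ (γ : ℝ) (_ : (γ • (1 : Matrix (Fin p) (Fin p) ℝ) - X).PosDef),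
          ((WassersteinShrinkage.convexObjective ρ S X γ : ℝ) : EReal)) ∧
      (𝒳.Nonempty → WassersteinShrinkage.droValue ρ 𝒳 S ≠ ⊤ ∧
        WassersteinShrinkage.droValue ρ 𝒳 S ≠ ⊥)) ∧
    ContinuousOn (fun S : Matrix (Fin p) (Fin p) ℝ => WassersteinShrinkage.droValue ρ 𝒳 S)
      {S | S.PosSemidef} := by
  open WassersteinShrinkage in
  refine ⟨fun S hS => ?_, ?_⟩
  · have hfix (X) (hX : X ∈ 𝒳) : worstCaseLoss ρ S X =
        ⨅ (γ : ℝ) (_ : (γ • (1 : Matrix (Fin p) (Fin p) ℝ) - X).PosDef),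
          ((convexObjective ρ S X γ : ℝ) : EReal) := by
      rw [worstCaseLoss_eq_realLoss hp (h𝒳 X hX) hρ hS,
        iInf_convexObjective_eq_realLoss hp (h𝒳 X hX) hρ hS]
    refine ⟨?_, hfix, fun hne => ?_⟩
    · rw [droValue, convexValue]
      apply le_antisymm
      · refine le_iInf fun X => le_iInf₂ fun γ h => iInf₂_le_of_le X h.1 ?_
        rw [hfix X h.1]
        exact iInf₂_le γ h.2.1
      · refine le_iInf₂ fun X hX => ?_
        rw [hfix X hX]
        exact le_iInf₂ fun γ hγ => iInf_le_of_le X (iInf₂_le γ ⟨hX, hγ, h𝒳 X hX⟩)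
    · rw [droValue_eq_realValue hp hρ h𝒳 hne hS]
      exact ⟨EReal.coe_ne_top _, EReal.coe_ne_bot _⟩
  · rcases 𝒳.eq_empty_or_nonempty with rfl | hne
    -- The empty infimum is the constant `⊤`.
    · simpa [droValue] using continuousOn_const
    · exact (continuous_coe_real_ereal.comp_continuousOn
        (continuousOn_realValue hp hρ h𝒳 hne)).congr
        fun S hS => droValue_eq_realValue hp hρ h𝒳 hne hS
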